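/- Let $d\ge 2$ be an integer, let $t$ be a real number with $-\frac1{d-1}\le t\le \frac1{d+1}$, and let $\Gamma_t$ be the transpose-depolarizing map on complex $d\times d$ matrices, $$\Gamma_t(X)=t\,X^{T}+(1-t)\,\mathrm{Tr}(X)\,\frac{I_d}{d},$$ where $T$ is the transpose in the standard basis. For a linear map $\Omega:\mathcal L(A)\to\mathcal L(C)$ between the operator algebras of finite-dimensional spaces $A\cong\mathbb C^{k}$ and $C$, put $$\upsilon_2(\Omega):=\sup_{B,\ \Lambda}\ \bigl\|(\Omega\otimes\mathrm{id}_B)\bigl((\mathrm{id}_A\otimes\Lambda)(\Phi)\bigr)\bigr\|_2 ,$$ where $B$ ranges over all finite-dimensional spaces, $\Lambda:\mathcal L(A')\to\mathcal L(B)$ ranges over all completely positive trace-preserving maps ($A'$ a copy of $A$), $\Phi=|\Phi\rangle\langle\Phi|$ with $|\Phi\rangle=k^{-1/2}\sum_{i=1}^{k}|i\rangle\otimes|i\rangle\in A\otimes A'$ is the maximally entangled state in the fixed (product) basis, and $\|X\|_2=\sqrt{\mathrm{Tr}(X^\dagger X)}$. Then for every $n\in\mathbb N$ (including $n=0$, where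 $\Gamma_t^{\otimes 0}$ is the identity on $\mathcal L(\mathbb C)$) $$\upsilon_2(\Gamma_t^{\otimes n})=\bigl(\upsilon_2(\Gamma_t)\bigr)^n ,\qquad\text{and}\qquad \upsilon_2(\Gamma_t)=\sqrt{\max\Bigl\{\frac1d,\ t^2+\frac{1-t^2}{d^2}\Bigr\}} .$$ Moreover, for $\Omega=\Gamma_t$ and for $\Omega=\Gamma_t^{\otimes n}$, the quantity $\upsilon_2(\Omega)$ equals the supremum of $\|(\Omega\otimes\mathrm{id}_B)(\sigma)\|_2$ over all finite-dimensional $B$ and all states $\sigma$ on $A\otimes B$ (that is, $\sigma\ge 0$ and $\mathrm{Tr}\,\sigma=1$) with $\mathrm{Tr}_B\,\sigma=I_A/\dim A$. -/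

import Mathlib

noncomputable section

namespace QuantumOutput

open scoped ENNReal Matrix

section Maps

variable {ι κ : Type}

/-- The map `Ω ⊗ id_B`, with operators on `A ⊗ B` written as matrices indexed by pairs: `Ω` acts on
each block obtained by fixing the row and the column index of `B`. -/
def tensorId (B : Type) (Ω : Matrix ι ι ℂ →ₗ[ℂ] Matrix κ κ ℂ) :
    Matrix (ι × B) (ι × B) ℂ →ₗ[ℂ] Matrix (κ × B) (κ × B) ℂ where
  toFun X := Matrix.of fun p q => Ω (Matrix.of fun i j => X (i, p.2) (j, q.2)) p.1 q.1
  map_add' X Y := by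
    ext p q
    exact congrFun (congrFun (Ω.map_add (Matrix.of fun i j => X (i, p.2) (j, q.2))
      (Matrix.of fun i j => Y (i, p.2) (j, q.2))) p.1) q.1
  map_smul' c X := by
    ext p q
    exact congrFun (congrFun (Ω.map_smul c (Matrix.of fun i j => X (i, p.2) (j, q.2))) p.1) q.1

/-- The map `id_A ⊗ Λ`. -/
def idTensor (A : Type) (Λ : Matrix ι ι ℂ →ₗ[ℂ] Matrix κ κ ℂ) :
    Matrix (A × ι) (A × ι) ℂ →ₗ[ℂ] Matrix (A × κ) (A × κ) ℂ where
  toFun X := Matrix.of fun p q => Λ (Matrix.of fun i j => X (p.1, i) (q.1, j)) p.2 q.2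
  map_add' X Y := by
    ext p q
    exact congrFun (congrFun (Λ.map_add (Matrix.of fun i j => X (p.1, i) (q.1, j))
      (Matrix.of fun i j => Y (p.1, i) (q.1, j))) p.2) q.2
  map_smul' c X := by
    ext p q
    exact congrFun (congrFun (Λ.map_smul c (Matrix.of fun i j => X (p.1, i) (q.1, j))) p.2) q.2

/-- The tensor product `X₁ ⊗ ⋯ ⊗ Xₙ` of matrices, in the product basis indexed by
`Fin n → ι`. -/
def piKronecker {n : ℕ} (X : Fin n → Matrix ι ι ℂ) : Matrix (Fin n → ι) (Fin n → ι) ℂ :=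
  Matrix.of fun x y => ∏ k, X k (x k) (y k)

variable [Fintype ι] [DecidableEq ι]

/-- The tensor power `Ω^{⊗ n}`: the linear map that sends the matrix unit
`E_{a₁ b₁} ⊗ ⋯ ⊗ E_{aₙ bₙ}` to `Ω(E_{a₁ b₁}) ⊗ ⋯ ⊗ Ω(E_{aₙ bₙ})`. -/
def tensorPower (n : ℕ) (Ω : Matrix ι ι ℂ →ₗ[ℂ] Matrix κ κ ℂ) :
    Matrix (Fin n → ι) (Fin n → ι) ℂ →ₗ[ℂ] Matrix (Fin n → κ) (Fin n → κ) ℂ where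
  toFun X := ∑ a, ∑ b, X a b • piKronecker fun k => Ω (Matrix.single (a k) (b k) 1)
  map_add' X Y := by simp only [Matrix.add_apply, add_smul, Finset.sum_add_distrib]
  map_smul' c X := by
    simp only [Matrix.smul_apply, smul_assoc, Finset.smul_sum, RingHom.id_apply]

/-- `Ω^{⊗ n}` acts factorwise on product operators. -/
theorem tensorPower_piKronecker (n : ℕ) (Ω : Matrix ι ι ℂ →ₗ[ℂ] Matrix κ κ ℂ)
    (X : Fin n → Matrix ι ι ℂ) :
    tensorPower n Ω (piKronecker X) = piKronecker fun k => Ω (X k) := by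
  have key : ∀ (Y : Matrix ι ι ℂ) (x y : κ),
      Ω Y x y = ∑ p : ι × ι, Y p.1 p.2 * Ω (Matrix.single p.1 p.2 1) x y := by
    intro Y x y
    conv_lhs => rw [Matrix.matrix_eq_sum_single Y]
    simp only [map_sum, Matrix.sum_apply, Fintype.sum_prod_type]
    refine Finset.sum_congr rfl fun i _ => Finset.sum_congr rfl fun j _ => ?_
    have : Matrix.single i j (Y i j) = Y i j • Matrix.single i j (1 : ℂ) := by
      rw [Matrix.smul_single, smul_eq_mul, mul_one]
    rw [this, map_smul, Matrix.smul_apply, smul_eq_mul]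
  ext x y
  simp only [tensorPower, piKronecker, LinearMap.coe_mk, AddHom.coe_mk, Matrix.sum_apply,
    Matrix.smul_apply, Matrix.of_apply, smul_eq_mul]
  simp_rw [key (X _) (x _) (y _)]
  rw [Finset.prod_univ_sum, Fintype.piFinset_univ, ← Fintype.sum_prod_type']
  simp_rw [← Finset.prod_mul_distrib]
  exact Fintype.sum_equiv (Equiv.arrowProdEquivProdArrow (Fin n) (fun _ => ι) fun _ => ι).symm _ _
    fun _ => rfl

end Maps

section States

open scoped ComplexOrder

variable {ι B : Type} [Fintype ι] [Fintype B]

/-- The Hilbert-Schmidt norm (Schatten `2`-norm) `‖X‖₂ = √(Tr (X† X))`. -/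
def hsNorm (X : Matrix ι ι ℂ) : ℝ := √(Matrix.trace (Xᴴ * X)).re

/-- The partial trace over the second tensor factor. -/
def partialTraceRight (σ : Matrix (ι × B) (ι × B) ℂ) : Matrix ι ι ℂ :=
  Matrix.of fun i j => ∑ b, σ (i, b) (j, b)

/-- The states on `A ⊗ B` whose marginal on `A` is maximally mixed. -/
def feasibleStates (ι B : Type) [Fintype ι] [DecidableEq ι] [Fintype B] :
    Set (Matrix (ι × B) (ι × B) ℂ) :=
  {σ | σ.PosSemidef ∧ σ.trace = 1 ∧ partialTraceRight σ = (Fintype.card ι : ℂ)⁻¹ • 1}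

/-- The normalized maximally entangled vector `|A|^{-1/2} ∑ᵢ |i⟩ ⊗ |i⟩`. -/
def maxEntangledVec (ι : Type) [Fintype ι] [DecidableEq ι] : ι × ι → ℂ :=
  fun p => if p.1 = p.2 then ((√(Fintype.card ι : ℝ))⁻¹ : ℝ) else 0

/-- The normalized maximally entangled state `Φ = |Φ⟩⟨Φ|`. For `ι = Fin n → Fin d`, with the
factors grouped as `A₁ ⋯ Aₙ` and `A'₁ ⋯ A'ₙ`, this is the `n`-th tensor power of the state for
`Fin d`. -/
def maxEntangled (ι : Type) [Fintype ι] [DecidableEq ι] : Matrix (ι × ι) (ι × ι) ℂ :=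
  Matrix.vecMulVec (maxEntangledVec ι) (star (maxEntangledVec ι))

end States

section Channels

open scoped Matrix.Norms.L2Operator MatrixOrder CStarAlgebra

/-- Completely positive, trace-preserving maps `L(A) → L(B)`. -/
def IsCPTP {ι B : Type} [Fintype ι] [DecidableEq ι] [Fintype B] [DecidableEq B]
    (Λ : Matrix ι ι ℂ →ₗ[ℂ] Matrix B B ℂ) : Prop :=
  (∃ φ : Matrix ι ι ℂ →CP Matrix B B ℂ, φ.toLinearMap = Λ) ∧
    ∀ X, (Λ X).trace = X.trace

end Channels

section Quantity

variable {ι κ : Type} [Fintype ι] [DecidableEq ι] [Fintype κ]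

/-- `υ₂(Ω)`: the supremum of `‖(Ω ⊗ id_B)((id_A ⊗ Λ)(Φ))‖₂` over all finite-dimensional systems `B`
and all channels `Λ : L(A') → L(B)`, as a supremum in `[0, ∞]`. -/
def upsilonTwo (Ω : Matrix ι ι ℂ →ₗ[ℂ] Matrix κ κ ℂ) : ℝ≥0∞ :=
  sSup {r | ∃ (B : Type) (_ : Fintype B) (_ : DecidableEq B) (Λ : Matrix ι ι ℂ →ₗ[ℂ] Matrix B B ℂ),
    IsCPTP Λ ∧ r = ENNReal.ofReal (hsNorm (tensorId B Ω (idTensor ι Λ (maxEntangled ι))))}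

/-- The supremum of `‖(Ω ⊗ id_B)(σ)‖₂` over all finite-dimensional systems `B` and all states `σ` on
`A ⊗ B` with maximally mixed `A`-marginal. -/
def upsilonTwoState (Ω : Matrix ι ι ℂ →ₗ[ℂ] Matrix κ κ ℂ) : ℝ≥0∞ :=
  sSup {r | ∃ (B : Type) (_ : Fintype B), ∃ σ ∈ feasibleStates ι B,
    r = ENNReal.ofReal (hsNorm (tensorId B Ω σ))}

end Quantity

/-- The transpose-depolarizing map `Γ_t(X) = t Xᵀ + (1 - t) Tr(X) I / d` on `d × d` matrices. -/
def transposeDepolarizing (d : ℕ) (t : ℝ) :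
    Matrix (Fin d) (Fin d) ℂ →ₗ[ℂ] Matrix (Fin d) (Fin d) ℂ where
  toFun X := (t : ℂ) • Xᵀ + ((1 - t : ℂ) * X.trace) • ((d : ℂ)⁻¹ • (1 : Matrix (Fin d) (Fin d) ℂ))
  map_add' X Y := by
    simp only [Matrix.transpose_add, Matrix.trace_add, smul_add, mul_add, add_smul]
    abel
  map_smul' c X := by
    simp only [Matrix.transpose_smul, Matrix.trace_smul, smul_eq_mul, RingHom.id_apply, smul_add,
      smul_smul]
    congr 2 <;> ring

end QuantumOutput

end

namespace QuantumOutput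

open scoped ENNReal Matrix

/-! ### The Hilbert-Schmidt norm through the Gram kernel. -/

section HilbertSchmidt

variable {ι κ : Type}

/-! The squared norm `‖(Ω ⊗ id)(σ)‖₂²` is an expectation in `σ ⊗ σ`, with its two `B` systems
exchanged, of the Gram kernel of `Ω` read as an operator `G` on `A ⊗ A`. Write `G = ∑ w |V⟩⟨V|`.
Factoring `σ = N† N`, each term `|V⟩⟨V|` gives a sum of products of amplitudes `conj f(b',b) *
f(b,b')`, which AM-GM bounds by `∑ |f(b,b')|²`. There the exchange is gone, and only the maximally
mixed marginal enters: the value is `‖V‖² / |A|²`. Hence the squared norm is at most `∑ |w| ‖V‖² /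
|A|²` (`sum_norm_sq_tensorId_le`), and this bound is multiplicative under tensor powers.

For `Γ_t`, `G = (1 - t²)/d · 1 + t² · SWAP`, diagonalised by the symmetric and antisymmetric
projections. The bound becomes the trace norm of `G` over `d²`, which is exactly the maximum
(`sum_abs_symWeight`).

Both terms of the maximum are attained, also for powers: `t² + (1 - t²)/d²` by `Λ = id`, and `1/d`
by `Λ = Tr`, since `Γ_t` is unital. Channels yield feasible states, so both suprema lie between the
same two bounds. -/

theorem hsNorm_eq_sqrt_sum [Fintype ι] (X : Matrix ι ι ℂ) : hsNorm X = √(∑ x, ∑ y, ‖X x y‖ ^ 2) := by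
  have h : Matrix.trace (Xᴴ * X) = ((∑ x, ∑ y, ‖X x y‖ ^ 2 : ℝ) : ℂ) := by
    simp only [Matrix.trace, Matrix.diag_apply, Matrix.mul_apply, Matrix.conjTranspose_apply]
    rw [Finset.sum_comm]
    push_cast
    refine Finset.sum_congr rfl fun i _ => Finset.sum_congr rfl fun j _ => ?_
    exact Complex.conj_mul' _
  rw [hsNorm, h, Complex.ofReal_re]

theorem map_apply_eq_sum_single [Fintype ι] [DecidableEq ι] (Ω : Matrix ι ι ℂ →ₗ[ℂ] Matrix κ κ ℂ)
    (Y : Matrix ι ι ℂ) (x y : κ) :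
    Ω Y x y = ∑ i, ∑ j, Y i j * Ω (Matrix.single i j 1) x y := by
  conv_lhs => rw [Matrix.matrix_eq_sum_single Y]
  simp only [map_sum, Matrix.sum_apply]
  refine Finset.sum_congr rfl fun i _ => Finset.sum_congr rfl fun j _ => ?_
  have : Matrix.single i j (Y i j) = Y i j • Matrix.single i j (1 : ℂ) := by
    rw [Matrix.smul_single, smul_eq_mul, mul_one]
  rw [this, map_smul, Matrix.smul_apply, smul_eq_mul]

/-- The Gram kernel `⟨Ω(E_{ij}), Ω(E_{kl})⟩` of `Ω` for the Hilbert-Schmidt inner product. -/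
def gramKernel [Fintype κ] [DecidableEq ι] (Ω : Matrix ι ι ℂ →ₗ[ℂ] Matrix κ κ ℂ) (i j k l : ι) : ℂ :=
  ∑ x, ∑ y, star (Ω (Matrix.single i j 1) x y) * Ω (Matrix.single k l 1) x y

theorem sum_norm_sq_map [Fintype ι] [Fintype κ] [DecidableEq ι] (Ω : Matrix ι ι ℂ →ₗ[ℂ] Matrix κ κ ℂ)
    (Y : Matrix ι ι ℂ) :
    ((∑ x, ∑ y, ‖Ω Y x y‖ ^ 2 : ℝ) : ℂ) =
      ∑ i, ∑ j, ∑ k, ∑ l, star (Y i j) * Y k l * gramKernel Ω i j k l := by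
  have h1 : ((∑ x, ∑ y, ‖Ω Y x y‖ ^ 2 : ℝ) : ℂ) = ∑ z : κ × κ, ∑ p : (ι × ι) × (ι × ι),
      star (Y p.1.1 p.1.2) * Y p.2.1 p.2.2 * (star (Ω (Matrix.single p.1.1 p.1.2 1) z.1 z.2) *
        Ω (Matrix.single p.2.1 p.2.2 1) z.1 z.2) := by
    rw [Fintype.sum_prod_type, Complex.ofReal_sum]
    refine Finset.sum_congr rfl fun x _ => ?_
    rw [Complex.ofReal_sum]
    refine Finset.sum_congr rfl fun y _ => ?_
    rw [Complex.ofReal_pow, ← Complex.conj_mul', starRingEnd_apply, map_apply_eq_sum_single Ω Y x y,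
      ← Fintype.sum_prod_type', star_sum, Finset.sum_mul_sum,
      Fintype.sum_prod_type (f := fun p : (ι × ι) × (ι × ι) => _)]
    refine Finset.sum_congr rfl fun p _ => Finset.sum_congr rfl fun q _ => ?_
    rw [star_mul']
    ring
  rw [h1, Finset.sum_comm]
  simp only [gramKernel, Fintype.sum_prod_type, Finset.mul_sum]

theorem sum_norm_sq_tensorId {B : Type} [Fintype κ] [Fintype B] (Ω : Matrix ι ι ℂ →ₗ[ℂ] Matrix κ κ ℂ)
    (σ : Matrix (ι × B) (ι × B) ℂ) :
    ∑ p, ∑ q, ‖tensorId B Ω σ p q‖ ^ 2 =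
      ∑ b, ∑ b', ∑ x, ∑ y, ‖Ω (Matrix.of fun i j => σ (i, b) (j, b')) x y‖ ^ 2 := by
  simp only [Fintype.sum_prod_type]
  have := Finset.sum_comm (s := (Finset.univ : Finset (κ × κ)))
    (t := (Finset.univ : Finset (B × B)))
    (f := fun z b => ‖Ω (Matrix.of fun i j => σ (i, b.1) (j, b.2)) z.1 z.2‖ ^ 2)
  simp only [Fintype.sum_prod_type] at this
  rw [← this]
  refine Finset.sum_congr rfl fun x _ => ?_
  rw [Finset.sum_comm]
  rfl

end HilbertSchmidt

/-! ### Upper bound from a decomposition of the Gram kernel. -/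

section UpperBound

variable {ι κ ν : Type} [Fintype ι] [Fintype κ] [Fintype ν]

/-- The Gram kernel of `Ω`, read as an operator on `A ⊗ A` after a partial transposition, is the
combination `∑ₙ wₙ |Vₙ⟩⟨Vₙ|`. -/
def HasGramDecomposition [DecidableEq ι] (Ω : Matrix ι ι ℂ →ₗ[ℂ] Matrix κ κ ℂ) (w : ν → ℝ)
    (V : ν → ι → ι → ℂ) : Prop :=
  ∀ i j k l, gramKernel Ω i j k l = ∑ s, (w s : ℂ) * (V s i l * star (V s j k))

/-- Keeping the four `B` indices free lets one identity serve both the exchanged pairing and the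
unexchanged one. -/
theorem sum_star_mul_eq_sum_factor {m B : Type} [Fintype m] {σ : Matrix (ι × B) (ι × B) ℂ}
    {N : Matrix m (ι × B) ℂ} (hN : σ = Nᴴ * N) (V : ι → ι → ℂ) (b₁ b₂ b₃ b₄ : B) :
    ∑ i, ∑ j, ∑ k, ∑ l, σ (j, b₁) (i, b₃) * σ (k, b₂) (l, b₄) * (V i l * star (V j k)) =
      ∑ r, ∑ s, star (∑ i, ∑ l, V i l * (N r (i, b₁) * N s (l, b₂))) *
        (∑ i, ∑ l, V i l * (N r (i, b₃) * N s (l, b₄))) := by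
  have hσ : ∀ p q, σ p q = ∑ r, star (N r p) * N r q := fun p q => by
    rw [hN, Matrix.mul_apply]; rfl
  have key := Finset.sum_comm (s := (Finset.univ : Finset (ι × ι × ι × ι)))
    (t := (Finset.univ : Finset (m × m)))
    (f := fun p r => (star (V p.2.1 p.2.2.1 * (N r.1 (p.2.1, b₁) * N r.2 (p.2.2.1, b₂)))) *
      (V p.1 p.2.2.2 * (N r.1 (p.1, b₃) * N r.2 (p.2.2.2, b₄))))
  simp only [Fintype.sum_prod_type] at key
  refine Eq.trans ?_ (key.trans ?_)
  · refine Finset.sum_congr rfl fun i _ => Finset.sum_congr rfl fun j _ =>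
      Finset.sum_congr rfl fun k _ => Finset.sum_congr rfl fun l _ => ?_
    rw [hσ, hσ, Finset.sum_mul_sum, Finset.sum_mul]
    refine Finset.sum_congr rfl fun r _ => ?_
    rw [Finset.sum_mul]
    refine Finset.sum_congr rfl fun s _ => ?_
    simp only [star_mul']
    ring
  · refine Finset.sum_congr rfl fun r _ => Finset.sum_congr rfl fun s _ => ?_
    simp only [star_sum]
    rw [Finset.mul_sum]
    refine Finset.sum_congr rfl fun i _ => ?_
    rw [Finset.sum_mul]
    refine Finset.sum_congr rfl fun j _ => ?_
    rw [Finset.sum_mul]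
    refine Finset.sum_congr rfl fun k _ => ?_
    rw [Finset.mul_sum]

/-- Exchanging the two `B` systems of `σ ⊗ σ` does not increase the expectation of a
positive operator on the two `A` systems. -/
theorem norm_sum_exchange_le {B : Type} [Fintype B] [DecidableEq ι]
    {σ : Matrix (ι × B) (ι × B) ℂ} (hσ : σ ∈ feasibleStates ι B) (V : ι → ι → ℂ) :
    ‖∑ b, ∑ b', ∑ i, ∑ j, ∑ k, ∑ l,
        σ (j, b') (i, b) * σ (k, b) (l, b') * (V i l * star (V j k))‖ ≤
      (∑ i, ∑ j, ‖V i j‖ ^ 2) / (Fintype.card ι : ℝ) ^ 2 := by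
  classical
  obtain ⟨hpos, -, hmarg⟩ := hσ
  obtain ⟨N, hN⟩ : ∃ N : Matrix (ι × B) (ι × B) ℂ, σ = Nᴴ * N := by
    open scoped MatrixOrder in
    exact CStarAlgebra.nonneg_iff_eq_star_mul_self.mp hpos.nonneg
  set f : (ι × B) → (ι × B) → B → B → ℂ :=
    fun r s b b' => ∑ i, ∑ l, V i l * (N r (i, b) * N s (l, b')) with hf
  have hS : ∀ b b', ∑ i, ∑ j, ∑ k, ∑ l,
      σ (j, b') (i, b) * σ (k, b) (l, b') * (V i l * star (V j k)) =
      ∑ r, ∑ s, star (f r s b' b) * f r s b b' :=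
    fun b b' => sum_star_mul_eq_sum_factor hN V b' b b b'
  -- Without the exchange, summing over `b` and `b'` traces out each `B` separately, leaving two
  -- maximally mixed marginals.
  have hT : ∑ b, ∑ b', ∑ r, ∑ s, star (f r s b b') * f r s b b' =
      ((∑ i, ∑ j, ‖V i j‖ ^ 2 : ℝ) : ℂ) / (Fintype.card ι : ℂ) ^ 2 := by
    have hT' : ∀ b b', ∑ r, ∑ s, star (f r s b b') * f r s b b' =
      ∑ i, ∑ j, ∑ k, ∑ l,
        σ (j, b) (i, b) * σ (k, b') (l, b') * (V i l * star (V j k)) :=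
      fun b b' => (sum_star_mul_eq_sum_factor hN V b b' b b').symm
    simp only [hT']
    have key := Finset.sum_comm (s := (Finset.univ : Finset (B × B)))
      (t := (Finset.univ : Finset (ι × ι × ι × ι)))
      (f := fun b p => σ (p.2.1, b.1) (p.1, b.1) * σ (p.2.2.1, b.2) (p.2.2.2, b.2) *
        (V p.1 p.2.2.2 * star (V p.2.1 p.2.2.1)))
    simp only [Fintype.sum_prod_type] at key
    rw [key]
    have hm : ∀ i j, ∑ b, σ (i, b) (j, b) = if i = j then (Fintype.card ι : ℂ)⁻¹ else 0 := by
      intro i j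
      have := congrFun (congrFun hmarg i) j
      simpa [partialTraceRight, Matrix.one_apply] using this
    have h2 : ∀ i j k l : ι, ∑ b, ∑ b', σ (j, b) (i, b) * σ (k, b') (l, b') *
        (V i l * star (V j k)) = (if j = i then (Fintype.card ι : ℂ)⁻¹ else 0) *
          (if k = l then (Fintype.card ι : ℂ)⁻¹ else 0) * (V i l * star (V j k)) := by
      intro i j k l
      rw [← hm, ← hm, Finset.sum_mul_sum, Finset.sum_mul]
      simp only [Finset.sum_mul]
    simp only [h2, ite_mul, mul_ite, zero_mul, mul_zero, Finset.sum_ite_eq, Finset.sum_ite_eq',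
      Finset.sum_const_zero, Finset.mem_univ, if_true, Finset.sum_ite_irrel]
    push_cast
    rw [Finset.sum_div]
    refine Finset.sum_congr rfl fun i _ => ?_
    rw [Finset.sum_div]
    refine Finset.sum_congr rfl fun j _ => ?_
    rw [← Complex.mul_conj', starRingEnd_apply]
    ring
  have hT2 : ∑ b, ∑ b', ∑ r, ∑ s, ‖f r s b b'‖ ^ 2 =
      (∑ i, ∑ j, ‖V i j‖ ^ 2) / (Fintype.card ι : ℝ) ^ 2 := by
    apply Complex.ofReal_injective
    push_cast
    push_cast at hT
    rw [← hT]
    simp only [← Complex.conj_mul', starRingEnd_apply]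
  rw [← hT2]
  -- Relabelling `b ↔ b'` shows that the termwise AM-GM bounds add up to the unexchanged total.
  have hT3 : ∑ b, ∑ b', ∑ r, ∑ s, (‖f r s b' b‖ ^ 2 + ‖f r s b b'‖ ^ 2) / 2 =
      ∑ b, ∑ b', ∑ r, ∑ s, ‖f r s b b'‖ ^ 2 := by
    have : ∑ b, ∑ b', ∑ r, ∑ s, ‖f r s b' b‖ ^ 2 = ∑ b, ∑ b', ∑ r, ∑ s, ‖f r s b b'‖ ^ 2 :=
      Finset.sum_comm
    simp only [add_div, Finset.sum_add_distrib, ← Finset.sum_div]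
    rw [this]
    ring
  rw [← hT3]
  simp only [hS]
  refine norm_sum_le_of_le _ fun b _ => norm_sum_le_of_le _ fun b' _ =>
    norm_sum_le_of_le _ fun r _ => norm_sum_le_of_le _ fun s _ => ?_
  rw [norm_mul, norm_star]
  nlinarith [sq_nonneg (‖f r s b' b‖ - ‖f r s b b'‖)]

theorem sum_norm_sq_tensorId_le {B : Type} [Fintype B] [DecidableEq ι]
    {Ω : Matrix ι ι ℂ →ₗ[ℂ] Matrix κ κ ℂ} {w : ν → ℝ} {V : ν → ι → ι → ℂ}
    (h : HasGramDecomposition Ω w V) {σ : Matrix (ι × B) (ι × B) ℂ}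
    (hσ : σ ∈ feasibleStates ι B) :
    ∑ p, ∑ q, ‖tensorId B Ω σ p q‖ ^ 2 ≤
      (∑ s, |w s| * ∑ i, ∑ j, ‖V s i j‖ ^ 2) / (Fintype.card ι : ℝ) ^ 2 := by
  -- Hermiticity turns the conjugated copy of `σ` into one with swapped indices; this is where the
  -- exchange of the `B` systems comes from.
  have hherm : ∀ p q, star (σ p q) = σ q p := fun p q => hσ.1.1.apply q p
  have hsum : ((∑ p, ∑ q, ‖tensorId B Ω σ p q‖ ^ 2 : ℝ) : ℂ) =
      ∑ s, (w s : ℂ) * ∑ b, ∑ b', ∑ i, ∑ j, ∑ k, ∑ l,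
        σ (j, b') (i, b) * σ (k, b) (l, b') * (V s i l * star (V s j k)) := by
    rw [sum_norm_sq_tensorId]
    rw [Complex.ofReal_sum]
    simp only [Complex.ofReal_sum Finset.univ (fun b' => ∑ x, ∑ y, _)]
    simp only [sum_norm_sq_map, Matrix.of_apply, hherm, h _ _ _ _]
    have key := Finset.sum_comm (s := (Finset.univ : Finset ν))
      (t := (Finset.univ : Finset (B × B × ι × ι × ι × ι)))
      (f := fun s p => (w s : ℂ) * (σ (p.2.2.2.1, p.2.1) (p.2.2.1, p.1) *
        σ (p.2.2.2.2.1, p.1) (p.2.2.2.2.2, p.2.1) *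
        (V s p.2.2.1 p.2.2.2.2.2 * star (V s p.2.2.2.1 p.2.2.2.2.1))))
    simp only [Fintype.sum_prod_type, ← Finset.mul_sum] at key
    rw [key]
    refine Finset.sum_congr rfl fun b _ => Finset.sum_congr rfl fun b' _ =>
      Finset.sum_congr rfl fun i _ => Finset.sum_congr rfl fun j _ =>
      Finset.sum_congr rfl fun k _ => Finset.sum_congr rfl fun l _ => ?_
    rw [Finset.mul_sum]
    exact Finset.sum_congr rfl fun s _ => by ring
  refine (le_abs_self _).trans ?_
  rw [← Real.norm_eq_abs, ← Complex.norm_real, hsum, Finset.sum_div]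
  refine norm_sum_le_of_le _ fun s _ => ?_
  rw [norm_mul, Complex.norm_real, Real.norm_eq_abs, mul_div_assoc]
  exact mul_le_mul_of_nonneg_left (norm_sum_exchange_le hσ (V s)) (abs_nonneg _)

end UpperBound

/-! ### Multiplicativity under tensor powers. -/

section TensorPower

variable {ι κ ν : Type} [Fintype ι] [Fintype ν] {n : ℕ}

theorem sum_sum_prod_apply [Fintype κ] {R : Type*} [CommSemiring R] (g : Fin n → ι → κ → R) :
    ∑ x : Fin n → ι, ∑ y : Fin n → κ, ∏ m, g m (x m) (y m) = ∏ m, ∑ u, ∑ v, g m u v := by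
  simp_rw [← Fintype.sum_prod_type']
  rw [Finset.prod_univ_sum, Fintype.piFinset_univ]
  exact Fintype.sum_equiv (Equiv.arrowProdEquivProdArrow (Fin n) (fun _ => ι) fun _ => κ).symm _ _
    fun _ => rfl

theorem sum_prod_apply {R : Type*} [CommSemiring R] (g : Fin n → ι → R) :
    ∑ x : Fin n → ι, ∏ m, g m (x m) = ∏ m, ∑ u, g m u := by
  rw [Finset.prod_univ_sum, Fintype.piFinset_univ]

theorem sum_abs_mul_sum_norm_sq_tensorPower (w : ν → ℝ) (V : ν → ι → ι → ℂ) :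
    ∑ s : Fin n → ν, |∏ m, w (s m)| * ∑ i : Fin n → ι, ∑ j : Fin n → ι,
        ‖∏ m, V (s m) (i m) (j m)‖ ^ 2 =
      (∑ s, |w s| * ∑ i, ∑ j, ‖V s i j‖ ^ 2) ^ n := by
  simp only [norm_prod, ← Finset.prod_pow, Finset.abs_prod]
  have := sum_prod_apply fun (_ : Fin n) s => |w s| * ∑ i, ∑ j, ‖V s i j‖ ^ 2
  rw [Finset.prod_const, Finset.card_univ, Fintype.card_fin] at this
  rw [← this]
  refine Finset.sum_congr rfl fun s _ => ?_
  rw [sum_sum_prod_apply fun m i j => ‖V (s m) i j‖ ^ 2, Finset.prod_mul_distrib]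

variable [DecidableEq ι]

theorem tensorPower_single (Ω : Matrix ι ι ℂ →ₗ[ℂ] Matrix κ κ ℂ) (a b : Fin n → ι) :
    tensorPower n Ω (Matrix.single a b 1) =
      piKronecker fun m => Ω (Matrix.single (a m) (b m) 1) := by
  rw [← tensorPower_piKronecker]
  congr 1
  ext x y
  simp only [Matrix.single_apply, piKronecker, Matrix.of_apply, Finset.prod_ite_zero,
    Finset.prod_const_one, Finset.mem_univ, true_imp_iff, funext_iff, forall_and]

theorem gramKernel_tensorPower [Fintype κ] (Ω : Matrix ι ι ℂ →ₗ[ℂ] Matrix κ κ ℂ) (i j k l : Fin n → ι) :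
    gramKernel (tensorPower n Ω) i j k l = ∏ m, gramKernel Ω (i m) (j m) (k m) (l m) := by
  simp only [gramKernel, tensorPower_single, piKronecker, Matrix.of_apply]
  rw [← sum_sum_prod_apply]
  simp only [star_prod, Finset.prod_mul_distrib]

theorem HasGramDecomposition.tensorPower [Fintype κ] {Ω : Matrix ι ι ℂ →ₗ[ℂ] Matrix κ κ ℂ} {w : ν → ℝ}
    {V : ν → ι → ι → ℂ} (h : HasGramDecomposition Ω w V) (n : ℕ) :
    HasGramDecomposition (tensorPower n Ω) (fun s : Fin n → ν => ∏ m, w (s m))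
      fun s i j => ∏ m, V (s m) (i m) (j m) := by
  intro i j k l
  rw [gramKernel_tensorPower]
  simp only [h _ _ _ _]
  rw [← sum_prod_apply]
  refine Finset.sum_congr rfl fun s _ => ?_
  simp only [Complex.ofReal_prod, star_prod, Finset.prod_mul_distrib]

theorem sum_norm_sq_tensorPower_single [Fintype κ] (Ω : Matrix ι ι ℂ →ₗ[ℂ] Matrix κ κ ℂ) :
    ∑ a : Fin n → ι, ∑ b : Fin n → ι, ∑ x, ∑ y,
        ‖tensorPower n Ω (Matrix.single a b 1) x y‖ ^ 2 =
      (∑ a, ∑ b, ∑ x, ∑ y, ‖Ω (Matrix.single a b 1) x y‖ ^ 2) ^ n := by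
  simp only [tensorPower_single, piKronecker, Matrix.of_apply, norm_prod, ← Finset.prod_pow]
  have := sum_sum_prod_apply
    fun (_ : Fin n) a b => ∑ x, ∑ y, ‖Ω (Matrix.single a b 1) x y‖ ^ 2
  rw [Finset.prod_const, Finset.card_univ, Fintype.card_fin] at this
  rw [← this]
  refine Finset.sum_congr rfl fun a _ => Finset.sum_congr rfl fun b _ => ?_
  rw [sum_sum_prod_apply fun m x y => ‖Ω (Matrix.single (a m) (b m) 1) x y‖ ^ 2]

theorem tensorPower_one (Ω : Matrix ι ι ℂ →ₗ[ℂ] Matrix ι ι ℂ) (h : Ω 1 = 1) (n : ℕ) :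
    tensorPower n Ω 1 = 1 := by
  have h1 : (piKronecker fun _ => 1 : Matrix (Fin n → ι) (Fin n → ι) ℂ) = 1 := by
    ext x y
    simp only [piKronecker, Matrix.of_apply, Matrix.one_apply, Finset.prod_ite_zero,
      Finset.prod_const_one, Finset.mem_univ, true_imp_iff, funext_iff]
  rw [← h1, tensorPower_piKronecker, h]

end TensorPower

/-! ### Spectrum of the Gram operator of `Γ_t`. -/

section TransposeDepolarizing

variable (d : ℕ) (t : ℝ)

theorem transposeDepolarizing_single (i j x y : Fin d) :
    transposeDepolarizing d t (Matrix.single i j 1) x y =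
      t * ((if j = x then 1 else 0) * if i = y then 1 else 0) +
        (1 - t) / d * ((if i = j then 1 else 0) * if x = y then 1 else 0) := by
  simp only [transposeDepolarizing, LinearMap.coe_mk, AddHom.coe_mk, Matrix.add_apply,
    Matrix.smul_apply, Matrix.transpose_apply, Matrix.single_apply, Matrix.one_apply, smul_eq_mul]
  have : Matrix.trace (Matrix.single i j (1 : ℂ)) = if i = j then 1 else 0 := by
    split_ifs with h
    · subst h; simp
    · exact Matrix.trace_single_eq_of_ne _ _ _ h
  rw [this]
  by_cases h1 : j = x <;> by_cases h2 : i = y <;> simp [h1, h2] <;> ring_nf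

theorem transposeDepolarizing_one (hd : d ≠ 0) : transposeDepolarizing d t 1 = 1 := by
  have : (d : ℂ) ≠ 0 := by exact_mod_cast hd
  simp only [transposeDepolarizing, LinearMap.coe_mk, AddHom.coe_mk, Matrix.transpose_one,
    Matrix.trace_one, Fintype.card_fin, smul_smul, ← add_smul]
  rw [mul_assoc, mul_inv_cancel₀ this]
  simp

theorem gramKernel_transposeDepolarizing (hd : d ≠ 0) (i j k l : Fin d) :
    gramKernel (transposeDepolarizing d t) i j k l =
      (t : ℂ) ^ 2 * ((if i = k then 1 else 0) * if j = l then 1 else 0) +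
        (1 - (t : ℂ) ^ 2) / d * ((if i = j then 1 else 0) * if k = l then 1 else 0) := by
  have hd' : (d : ℂ) ≠ 0 := by exact_mod_cast hd
  simp only [gramKernel, transposeDepolarizing_single]
  simp only [star_add, star_mul', Complex.star_def, Complex.conj_ofReal, map_div₀, map_sub,
    map_one, Complex.conj_natCast, apply_ite (starRingEnd ℂ), map_zero]
  simp only [add_mul, mul_add, Finset.sum_add_distrib, mul_ite, ite_mul, mul_zero, zero_mul,
    mul_one, Finset.sum_ite_eq, Finset.mem_univ, if_true,
    Finset.sum_ite_irrel, Finset.sum_const_zero, Finset.sum_const, Finset.card_univ,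
    Fintype.card_fin, nsmul_eq_mul]
  by_cases h1 : i = k <;> by_cases h2 : j = l <;> by_cases h3 : i = j <;> by_cases h4 : k = l <;>
    simp_all [eq_comm] <;> field_simp <;> ring

/-- The columns of the projections onto the symmetric and antisymmetric subspaces. -/
noncomputable def symProjection (s : Bool × Fin d × Fin d) (i j : Fin d) : ℂ :=
  ((if s.2.1 = i then 1 else 0) * (if s.2.2 = j then 1 else 0) +
    (if s.1 then 1 else -1) * ((if s.2.1 = j then 1 else 0) * (if s.2.2 = i then 1 else 0))) / 2

/-- The columns of a projection `P` satisfy `∑ |P e⟩⟨P e| = P P† = P`, here with `P = (1 ± SWAP)/2`,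
row index `(i, l)` and column index `(j, k)`. -/
theorem sum_symProjection (e : Bool) (i j k l : Fin d) :
    ∑ a, ∑ b, symProjection d (e, a, b) i l * star (symProjection d (e, a, b) j k) =
      ((if i = j then 1 else 0) * (if l = k then 1 else 0) +
        (if e then 1 else -1) * ((if i = k then 1 else 0) * (if j = l then 1 else 0))) / 2 := by
  simp only [symProjection]
  simp only [star_add, Complex.star_def, map_div₀, apply_ite (starRingEnd ℂ), map_neg,
    map_one, map_zero, map_mul, map_ofNat, add_div]
  simp only [add_mul, mul_add, Finset.sum_add_distrib, mul_ite, ite_mul, mul_zero, zero_mul,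
    mul_one, ite_div, zero_div, Finset.sum_ite_eq', Finset.mem_univ, if_true]
  cases e <;> by_cases h1 : i = j <;> by_cases h2 : l = k <;> by_cases h3 : i = k <;>
    by_cases h4 : j = l <;> simp_all [eq_comm] <;> ring

/-- The eigenvalues of the partially transposed Gram kernel of `Γ_t`. -/
noncomputable def symWeight (s : Bool × Fin d × Fin d) : ℝ :=
  (1 - t ^ 2) / d + (if s.1 then 1 else -1) * t ^ 2

theorem hasGramDecomposition_transposeDepolarizing (hd : d ≠ 0) :
    HasGramDecomposition (transposeDepolarizing d t) (symWeight d t) (symProjection d) := by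
  intro i j k l
  rw [gramKernel_transposeDepolarizing d t hd]
  simp only [Fintype.sum_prod_type, symWeight, ← Finset.mul_sum, sum_symProjection,
    Fintype.sum_bool, if_true, Bool.false_eq_true, if_false, eq_comm (a := l)]
  push_cast
  ring

/-- The squared norms of the columns add up to the ranks `(d² ± d)/2`, so the left side is a trace
norm over `d²`. The symmetric eigenvalue is never negative. -/
theorem sum_abs_symWeight (hd : 2 ≤ d) :
    (∑ s, |symWeight d t s| * ∑ i, ∑ j, ‖symProjection d s i j‖ ^ 2) / (d : ℝ) ^ 2 =
      max (1 / (d : ℝ)) (t ^ 2 + (1 - t ^ 2) / (d : ℝ) ^ 2) := by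
  have hd0 : (0 : ℝ) < d := by positivity
  have hd1 : (2 : ℝ) ≤ d := by exact_mod_cast hd
  have hcount : ∀ e : Bool, ∑ a, ∑ b, ∑ i, ∑ j, ‖symProjection d (e, a, b) i j‖ ^ 2 =
      ((d : ℝ) ^ 2 + (if e then 1 else -1) * d) / 2 := by
    intro e
    have key := Finset.sum_comm (s := (Finset.univ : Finset (Fin d × Fin d)))
      (t := (Finset.univ : Finset (Fin d × Fin d)))
      (f := fun s p => ‖symProjection d (e, s.1, s.2) p.1 p.2‖ ^ 2)
    simp only [Fintype.sum_prod_type] at key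
    rw [key]
    apply Complex.ofReal_injective
    push_cast
    simp only [← Complex.mul_conj', starRingEnd_apply, sum_symProjection]
    simp only [← Finset.sum_div, Finset.sum_add_distrib, mul_ite, mul_zero, mul_one, if_true,
      Finset.sum_ite_eq,
      Finset.mem_univ, Finset.sum_const, Finset.card_univ, Fintype.card_fin, nsmul_eq_mul]
    cases e <;> simp <;> ring
  have hsum : ∑ s, |symWeight d t s| * ∑ i, ∑ j, ‖symProjection d s i j‖ ^ 2 =
      |(1 - t ^ 2) / d + t ^ 2| * (((d : ℝ) ^ 2 + d) / 2) +
        |(1 - t ^ 2) / d - t ^ 2| * (((d : ℝ) ^ 2 - d) / 2) := by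
    simp only [Fintype.sum_prod_type, symWeight, ← Finset.mul_sum, hcount, Fintype.sum_bool,
      if_true, Bool.false_eq_true, if_false]
    ring_nf
  have hplus : 0 ≤ (1 - t ^ 2) / d + t ^ 2 := by
    have : (1 - t ^ 2) / d + t ^ 2 = (1 + (d - 1) * t ^ 2) / d := by field_simp; ring
    rw [this]
    have : 0 ≤ (d - 1) * t ^ 2 := mul_nonneg (by linarith) (sq_nonneg t)
    positivity
  have hdiff : 1 / (d : ℝ) - (t ^ 2 + (1 - t ^ 2) / (d : ℝ) ^ 2) =
      ((1 - t ^ 2) / d - t ^ 2) * (1 - 1 / d) := by field_simp; ring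
  have hfac : (0 : ℝ) ≤ 1 - 1 / d := by
    rw [sub_nonneg, div_le_one hd0]; linarith
  rw [hsum, abs_of_nonneg hplus]
  -- The sign of the antisymmetric eigenvalue decides which term is the maximum, by `hdiff`. If it
  -- is nonnegative, the trace norm is just the trace, `d`.
  rcases le_total 0 ((1 - t ^ 2) / d - t ^ 2) with h | h
  · rw [abs_of_nonneg h, max_eq_left (by nlinarith [mul_nonneg h hfac])]
    field_simp
    ring
  · rw [abs_of_nonpos h, max_eq_right (by nlinarith [mul_nonneg (neg_nonneg.2 h) hfac])]
    field_simp
    ring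

theorem sum_norm_sq_transposeDepolarizing_single (hd : d ≠ 0) :
    (∑ a, ∑ b, ∑ x, ∑ y, ‖transposeDepolarizing d t (Matrix.single a b 1) x y‖ ^ 2) /
      (d : ℝ) ^ 2 = t ^ 2 + (1 - t ^ 2) / (d : ℝ) ^ 2 := by
  have hd' : (d : ℂ) ≠ 0 := by exact_mod_cast hd
  apply Complex.ofReal_injective
  push_cast
  simp only [← Complex.conj_mul', starRingEnd_apply]
  have := gramKernel_transposeDepolarizing d t hd
  simp only [gramKernel] at this
  simp only [this, if_true, mul_one, Finset.sum_add_distrib, Finset.sum_const, Finset.card_univ,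
    Fintype.card_fin, nsmul_eq_mul, mul_ite, mul_zero, Finset.sum_ite_eq, Finset.mem_univ]
  field_simp

end TransposeDepolarizing

/-! ### The two channels used as witnesses, and Choi states. -/

section Channels

open scoped Matrix.Norms.L2Operator MatrixOrder CStarAlgebra ComplexOrder

variable {ι B : Type} [Fintype ι] [DecidableEq ι] [Fintype B] [DecidableEq B]

theorem isCPTP_id : IsCPTP (LinearMap.id : Matrix ι ι ℂ →ₗ[ℂ] Matrix ι ι ℂ) := by
  refine ⟨⟨⟨LinearMap.id, fun k M hM => ?_⟩, rfl⟩, fun X => rfl⟩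
  exact hM

/-- The trace, as a map onto the operators on a one-dimensional space. -/
def traceMap (ι : Type) [Fintype ι] : Matrix ι ι ℂ →ₗ[ℂ] Matrix Unit Unit ℂ where
  toFun X := Matrix.of fun _ _ => X.trace
  map_add' X Y := by ext; simp
  map_smul' c X := by ext; simp

theorem exists_eq_star_mul_self {A : Type*} [NonUnitalCStarAlgebra A] [PartialOrder A]
    [StarOrderedRing A] {a : A} (ha : 0 ≤ a) : ∃ b, a = star b * b :=
  CStarAlgebra.nonneg_iff_eq_star_mul_self.mp ha

theorem isCPTP_traceMap : IsCPTP (traceMap ι) := by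
  refine ⟨⟨⟨traceMap ι, fun k M hM => ?_⟩, rfl⟩, fun X => by simp [traceMap, Matrix.trace]⟩
  obtain ⟨N, rfl⟩ := exists_eq_star_mul_self hM
  -- `Z a b` collects the `(a, b)` entries of the blocks of `N`; the trace of a block of `N† N` is a
  -- sum over these entries.
  let Z : ι → ι → CStarMatrix (Fin k) (Fin k) (Matrix Unit Unit ℂ) := fun a b =>
    CStarMatrix.ofMatrix (Matrix.of fun r i => Matrix.of fun _ _ => N r i a b)
  have h : (star N * N).map (traceMap ι) = ∑ a, ∑ b, star (Z a b) * Z a b := by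
    ext i j u v
    simp only [CStarMatrix.map_apply, CStarMatrix.mul_apply, CStarMatrix.star_apply]
    have hsum : ∀ f : ι → CStarMatrix (Fin k) (Fin k) (Matrix Unit Unit ℂ),
        (∑ a, f a) i j = ∑ a, f a i j := fun f => Matrix.sum_apply i j Finset.univ f
    simp only [hsum, CStarMatrix.mul_apply, CStarMatrix.star_apply, Matrix.sum_apply,
      Matrix.mul_apply, Matrix.star_apply, traceMap, LinearMap.coe_mk, AddHom.coe_mk,
      Matrix.of_apply, Matrix.trace, Matrix.diag_apply, Z, CStarMatrix.ofMatrix_apply,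
      Fintype.sum_unique]
    have key := Finset.sum_comm (s := (Finset.univ : Finset (ι × ι)))
      (t := (Finset.univ : Finset (Fin k)))
      (f := fun p r => star (N r i p.1 p.2) * N r j p.1 p.2)
    simp only [Fintype.sum_prod_type] at key
    rw [key, Finset.sum_comm]
    exact Finset.sum_congr rfl fun r _ => Finset.sum_comm
  rw [h]
  exact Finset.sum_nonneg fun a _ => Finset.sum_nonneg fun b _ => star_mul_self_nonneg _

theorem idTensor_maxEntangled_apply {κ : Type} (Λ : Matrix ι ι ℂ →ₗ[ℂ] Matrix κ κ ℂ)
    (p q : ι × κ) :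
    idTensor ι Λ (maxEntangled ι) p q =
      (Fintype.card ι : ℂ)⁻¹ * Λ (Matrix.single p.1 q.1 1) p.2 q.2 := by
  have h : (Matrix.of fun i j => maxEntangled ι (p.1, i) (q.1, j)) =
      (Fintype.card ι : ℂ)⁻¹ • Matrix.single p.1 q.1 1 := by
    have hc : (((√(Fintype.card ι : ℝ))⁻¹ : ℝ) : ℂ) * (((√(Fintype.card ι : ℝ))⁻¹ : ℝ) : ℂ) =
        (Fintype.card ι : ℂ)⁻¹ := by
      rw [← Complex.ofReal_mul, ← mul_inv, Real.mul_self_sqrt (Nat.cast_nonneg _)]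
      simp
    ext i j
    simp only [maxEntangled, maxEntangledVec, Matrix.of_apply, Matrix.vecMulVec_apply,
      Pi.star_apply, Matrix.smul_apply, Matrix.single_apply, smul_eq_mul, ← hc]
    by_cases h1 : p.1 = i <;> by_cases h2 : q.1 = j <;> simp [h1, h2]
  simp only [idTensor, LinearMap.coe_mk, AddHom.coe_mk, Matrix.of_apply]
  rw [h, map_smul, Matrix.smul_apply, smul_eq_mul]

/-- One direction of Choi's theorem: the block matrix of all matrix units is positive, hence so is
its image under `φ`. -/
theorem posSemidef_of_completelyPositive [Nonempty ι] (φ : Matrix ι ι ℂ →CP Matrix B B ℂ) :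
    (Matrix.of fun p q : ι × B => φ.toLinearMap (Matrix.single p.1 q.1 1) p.2 q.2).PosSemidef := by
  obtain ⟨o⟩ := ‹Nonempty ι›
  -- Only row `o` is nonzero, with entries `E_{oi}`, so `P† P` has blocks `E_{io} E_{oj} = E_{ij}`.
  let P : CStarMatrix ι ι (Matrix ι ι ℂ) := CStarMatrix.ofMatrix
    (Matrix.of fun r i => if r = o then Matrix.single r i 1 else 0)
  have hP : ∀ i j, (star P * P) i j = Matrix.single i j 1 := by
    intro i j
    rw [CStarMatrix.mul_apply, Finset.sum_eq_single o]
    · simp [P, CStarMatrix.star_apply, Matrix.star_eq_conjTranspose]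
    · intro r _ hr
      simp [P, hr]
    · simp
  obtain ⟨Q, hQ⟩ := exists_eq_star_mul_self (φ.map_cstarMatrix_nonneg _ (star_mul_self_nonneg P))
  let N : Matrix (ι × B) (ι × B) ℂ := Matrix.of fun r p => Q r.1 p.1 r.2 p.2
  have hN : (Matrix.of fun p q : ι × B => φ.toLinearMap (Matrix.single p.1 q.1 1) p.2 q.2) =
      Nᴴ * N := by
    ext p q
    have h := congrArg (fun X => X p.1 q.1) hQ
    simp only [CStarMatrix.map_apply, hP, CStarMatrix.mul_apply, CStarMatrix.star_apply] at h
    have h' := congrArg (fun X => X p.2 q.2) h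
    simp only [Matrix.sum_apply, Matrix.mul_apply, Matrix.star_apply] at h'
    rw [Matrix.mul_apply, Fintype.sum_prod_type]
    exact h'
  rw [hN]
  exact Matrix.posSemidef_conjTranspose_mul_self N

theorem IsCPTP.idTensor_maxEntangled_mem [Nonempty ι] {Λ : Matrix ι ι ℂ →ₗ[ℂ] Matrix B B ℂ}
    (hΛ : IsCPTP Λ) : idTensor ι Λ (maxEntangled ι) ∈ feasibleStates ι B := by
  obtain ⟨⟨φ, rfl⟩, htr⟩ := hΛ
  have hcard : (Fintype.card ι : ℂ) ≠ 0 := by simp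
  have htr' : ∀ i j, ∑ b, φ.toLinearMap (Matrix.single i j 1) b b = if i = j then 1 else 0 := by
    intro i j
    refine (htr (Matrix.single i j 1)).trans ?_
    split_ifs with h
    · subst h; simp
    · exact Matrix.trace_single_eq_of_ne _ _ _ h
  refine ⟨?_, ?_, ?_⟩
  · have : idTensor ι φ.toLinearMap (maxEntangled ι) = (Fintype.card ι : ℝ)⁻¹ •
        (Matrix.of fun p q : ι × B => φ.toLinearMap (Matrix.single p.1 q.1 1) p.2 q.2) := by
      ext p q
      rw [idTensor_maxEntangled_apply]
      simp
    rw [this]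
    exact (posSemidef_of_completelyPositive φ).smul (by positivity)
  · simp only [Matrix.trace, Matrix.diag_apply, idTensor_maxEntangled_apply,
      Fintype.sum_prod_type, ← Finset.mul_sum, htr', if_true]
    simp
  · ext i j
    simp only [partialTraceRight, Matrix.of_apply, idTensor_maxEntangled_apply, ← Finset.mul_sum,
      htr', Matrix.smul_apply, Matrix.one_apply, smul_eq_mul]

end Channels

/-! ### Bounds on the two suprema. -/

section Quantity

variable {ι κ ν : Type} [Fintype ι] [DecidableEq ι] [Fintype κ] [Fintype ν]

theorem upsilonTwo_le_upsilonTwoState [Nonempty ι] (Ω : Matrix ι ι ℂ →ₗ[ℂ] Matrix κ κ ℂ) :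
    upsilonTwo Ω ≤ upsilonTwoState Ω := by
  refine sSup_le_sSup ?_
  rintro r ⟨B, _, _, Λ, hΛ, rfl⟩
  exact ⟨B, inferInstance, _, hΛ.idTensor_maxEntangled_mem, rfl⟩

theorem upsilonTwoState_le {Ω : Matrix ι ι ℂ →ₗ[ℂ] Matrix κ κ ℂ} {w : ν → ℝ}
    {V : ν → ι → ι → ℂ} (h : HasGramDecomposition Ω w V) :
    upsilonTwoState Ω ≤ ENNReal.ofReal
      √((∑ s, |w s| * ∑ i, ∑ j, ‖V s i j‖ ^ 2) / (Fintype.card ι : ℝ) ^ 2) := by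
  refine sSup_le ?_
  rintro r ⟨B, _, σ, hσ, rfl⟩
  rw [hsNorm_eq_sqrt_sum]
  exact ENNReal.ofReal_le_ofReal (Real.sqrt_le_sqrt (sum_norm_sq_tensorId_le h hσ))

/-- The maximally entangled state itself is a candidate for `υ₂`. -/
theorem le_upsilonTwo_of_maxEntangled (Ω : Matrix ι ι ℂ →ₗ[ℂ] Matrix κ κ ℂ) :
    ENNReal.ofReal √((∑ a, ∑ b, ∑ x, ∑ y, ‖Ω (Matrix.single a b 1) x y‖ ^ 2) /
      (Fintype.card ι : ℝ) ^ 2) ≤ upsilonTwo Ω := by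
  refine le_sSup ⟨ι, inferInstance, inferInstance, LinearMap.id, isCPTP_id, ?_⟩
  congr 1
  rw [hsNorm_eq_sqrt_sum, sum_norm_sq_tensorId]
  congr 1
  simp only [Finset.sum_div]
  refine Finset.sum_congr rfl fun a _ => Finset.sum_congr rfl fun b _ => ?_
  have : (Matrix.of fun i j => idTensor ι LinearMap.id (maxEntangled ι) (i, a) (j, b)) =
      (Fintype.card ι : ℂ)⁻¹ • Matrix.single a b 1 := by
    ext i j
    simp only [idTensor_maxEntangled_apply, Matrix.of_apply, LinearMap.id_apply,
      Matrix.smul_apply, smul_eq_mul, Matrix.single_apply, eq_comm]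
  rw [this, map_smul]
  refine Finset.sum_congr rfl fun x _ => Finset.sum_congr rfl fun y _ => ?_
  rw [Matrix.smul_apply, norm_smul, norm_inv, Complex.norm_natCast]
  ring

/-- The product of the maximally mixed state with a pure state is a candidate for `υ₂`. -/
theorem le_upsilonTwo_of_map_one [Nonempty ι] {Ω : Matrix ι ι ℂ →ₗ[ℂ] Matrix ι ι ℂ} (h : Ω 1 = 1) :
    ENNReal.ofReal √(1 / (Fintype.card ι : ℝ)) ≤ upsilonTwo Ω := by
  refine le_sSup ⟨Unit, inferInstance, inferInstance, traceMap ι, isCPTP_traceMap, ?_⟩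
  congr 1
  rw [hsNorm_eq_sqrt_sum, sum_norm_sq_tensorId]
  congr 1
  have : ∀ b b', (Matrix.of fun i j => idTensor ι (traceMap ι) (maxEntangled ι) (i, b) (j, b')) =
      (Fintype.card ι : ℂ)⁻¹ • 1 := by
    intro b b'
    ext i j
    simp only [idTensor_maxEntangled_apply, Matrix.of_apply, Matrix.smul_apply, smul_eq_mul,
      Matrix.one_apply, traceMap, LinearMap.coe_mk, AddHom.coe_mk]
    split_ifs with h
    · subst h; simp
    · rw [Matrix.trace_single_eq_of_ne _ _ _ h]
  have hsq : ∀ x y : ι, ‖((Fintype.card ι : ℂ)⁻¹ • (1 : Matrix ι ι ℂ)) x y‖ ^ 2 =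
      if x = y then ((Fintype.card ι : ℝ)⁻¹) ^ 2 else 0 := by
    intro x y
    rw [Matrix.smul_apply, Matrix.one_apply]
    split_ifs <;> simp
  have hcard : (Fintype.card ι : ℝ) ≠ 0 := by simp
  simp only [this, map_smul, h, hsq, Finset.sum_ite_eq,
    Finset.mem_univ, if_true, Finset.sum_const, Finset.card_univ, nsmul_eq_mul]
  rw [Fintype.card_unit]
  field_simp
  norm_num

end Quantity

/-! ### Matching the bounds. -/

section Multiplicativity

/-! Both values hold for every real `t`; the bounds that make `Γ_t` a channel are not needed. -/

variable (d : ℕ) (t : ℝ)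

theorem upsilonTwo_transposeDepolarizing (hd : 2 ≤ d) :
    upsilonTwo (transposeDepolarizing d t) =
        ENNReal.ofReal √(max (1 / (d : ℝ)) (t ^ 2 + (1 - t ^ 2) / (d : ℝ) ^ 2)) ∧
      upsilonTwoState (transposeDepolarizing d t) =
        upsilonTwo (transposeDepolarizing d t) := by
  have hd0 : d ≠ 0 := by omega
  have : NeZero d := ⟨hd0⟩
  set M := max (1 / (d : ℝ)) (t ^ 2 + (1 - t ^ 2) / (d : ℝ) ^ 2) with hM
  have hupper : upsilonTwoState (transposeDepolarizing d t) ≤ ENNReal.ofReal √M := by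
    have := upsilonTwoState_le (hasGramDecomposition_transposeDepolarizing d t hd0)
    rwa [Fintype.card_fin, sum_abs_symWeight d t hd] at this
  have hlower : ENNReal.ofReal √M ≤ upsilonTwo (transposeDepolarizing d t) := by
    rcases max_choice (1 / (d : ℝ)) (t ^ 2 + (1 - t ^ 2) / (d : ℝ) ^ 2) with h | h
    · have := le_upsilonTwo_of_map_one (transposeDepolarizing_one d t hd0)
      rwa [Fintype.card_fin, ← h] at this
    · have := le_upsilonTwo_of_maxEntangled (transposeDepolarizing d t)
      rwa [Fintype.card_fin, sum_norm_sq_transposeDepolarizing_single d t hd0, ← h] at this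
  have hle := upsilonTwo_le_upsilonTwoState (transposeDepolarizing d t)
  exact ⟨le_antisymm (hle.trans hupper) hlower, le_antisymm (hupper.trans hlower) hle⟩

/-- The case `n = 0` needs no separate treatment: `Fin 0 → Fin d` has one point and all products are
empty. -/
theorem upsilonTwo_tensorPower_transposeDepolarizing (hd : 2 ≤ d) (n : ℕ) :
    upsilonTwo (tensorPower n (transposeDepolarizing d t)) =
        ENNReal.ofReal √(max (1 / (d : ℝ)) (t ^ 2 + (1 - t ^ 2) / (d : ℝ) ^ 2)) ^ n ∧
      upsilonTwoState (tensorPower n (transposeDepolarizing d t)) =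
        upsilonTwo (tensorPower n (transposeDepolarizing d t)) := by
  have hd0 : d ≠ 0 := by omega
  have : NeZero d := ⟨hd0⟩
  set M := max (1 / (d : ℝ)) (t ^ 2 + (1 - t ^ 2) / (d : ℝ) ^ 2) with hM
  have hM0 : 0 ≤ M := le_max_of_le_left (by positivity)
  have hpow : ENNReal.ofReal √M ^ n = ENNReal.ofReal √(M ^ n) := by
    rw [← ENNReal.ofReal_pow (Real.sqrt_nonneg _)]
    congr 1
    rw [eq_comm, Real.sqrt_eq_iff_mul_self_eq (pow_nonneg hM0 _) (by positivity), ← mul_pow,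
      Real.mul_self_sqrt hM0]
  rw [hpow]
  have hcard : (Fintype.card (Fin n → Fin d) : ℝ) = (d : ℝ) ^ n := by simp
  have hupper : upsilonTwoState (tensorPower n (transposeDepolarizing d t)) ≤
      ENNReal.ofReal √(M ^ n) := by
    have := upsilonTwoState_le ((hasGramDecomposition_transposeDepolarizing d t hd0).tensorPower n)
    rwa [sum_abs_mul_sum_norm_sq_tensorPower, hcard, pow_right_comm, ← div_pow,
      sum_abs_symWeight d t hd] at this
  have hlower : ENNReal.ofReal √(M ^ n) ≤
      upsilonTwo (tensorPower n (transposeDepolarizing d t)) := by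
    -- `M ^ n` is the `n`-th power of whichever term is the maximum, so the witness for that term on
    -- one copy has its analogue on `n` copies.
    rcases max_choice (1 / (d : ℝ)) (t ^ 2 + (1 - t ^ 2) / (d : ℝ) ^ 2) with h | h
    · have := le_upsilonTwo_of_map_one (tensorPower_one _ (transposeDepolarizing_one d t hd0) n)
      rwa [hcard, ← one_div_pow, ← h] at this
    · have := le_upsilonTwo_of_maxEntangled (tensorPower n (transposeDepolarizing d t))
      rwa [sum_norm_sq_tensorPower_single, hcard, pow_right_comm, ← div_pow,
        sum_norm_sq_transposeDepolarizing_single d t hd0, ← h] at this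
  have hle := upsilonTwo_le_upsilonTwoState (tensorPower n (transposeDepolarizing d t))
  exact ⟨le_antisymm (hle.trans hupper) hlower, le_antisymm (hupper.trans hlower) hle⟩

end Multiplicativity

end QuantumOutput

theorem mainTheorem1 (d : ℕ) (hd : 2 ≤ d) (t : ℝ)
    (ht₁ : -(1 / ((d : ℝ) - 1)) ≤ t) (ht₂ : t ≤ 1 / ((d : ℝ) + 1)) (n : ℕ) :
    QuantumOutput.upsilonTwo
        (QuantumOutput.tensorPower n (QuantumOutput.transposeDepolarizing d t)) =
      QuantumOutput.upsilonTwo (QuantumOutput.transposeDepolarizing d t) ^ n ∧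
    QuantumOutput.upsilonTwo (QuantumOutput.transposeDepolarizing d t) =
      ENNReal.ofReal (√(max (1 / (d : ℝ)) (t ^ 2 + (1 - t ^ 2) / (d : ℝ) ^ 2))) ∧
    QuantumOutput.upsilonTwoState
        (QuantumOutput.tensorPower n (QuantumOutput.transposeDepolarizing d t)) =
      QuantumOutput.upsilonTwo
        (QuantumOutput.tensorPower n (QuantumOutput.transposeDepolarizing d t)) ∧
    QuantumOutput.upsilonTwoState (QuantumOutput.transposeDepolarizing d t) =
      QuantumOutput.upsilonTwo (QuantumOutput.transposeDepolarizing d t) := by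
  obtain ⟨h₁, h₁'⟩ := QuantumOutput.upsilonTwo_transposeDepolarizing d t hd
  obtain ⟨h₂, h₂'⟩ := QuantumOutput.upsilonTwo_tensorPower_transposeDepolarizing d t hd n
  exact ⟨by rw [h₂, h₁], h₁, h₂', h₁'⟩
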